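/- All graphs are finite, simple and non-empty. For a graph $G$ let $\Delta(G)$ and $\delta(G)$ be its maximum and minimum degree, $\chi'(G)$ its chromatic index (the least number of colours in a proper edge-colouring), $\alpha(G)$ the maximum cardinality of an independent set of vertices, $\iota(G)=\alpha(G)/|V(G)|$ its independence ratio, and $V_i(G)$ the set of vertices of degree $i$. For $k\ge 2$, a graph $G$ is $k$-critical if it is connected, $\Delta(G)=k$, $\chi'(G)=k+1$, and $\chi'(G-e)=k$ for every $e\in E(G)$. Let $\mathcal C(k)$ be the class of $k$-critical graphs. For $k\ge 2$ and $t\ge 0$ let $\mathcal C(k,t)$ be the class of $k$-critical graphs $G$ such that 1. $\delta(G)\ge k-1$, and 2. one can choose, for every $v\in V_{k-1}(G)$, paths $p_1(v),\dots,p_{k-1}(v)$ in $G$ with initial vertex $v$ such that for all $v\in V_{k-1}(G)$ and all $i,j\in\{1,\dots,k-1\}$: (a) $V(p_i(v))\cap V_{k-1}(G)=\{v\}$; (b) $|V(p_i(v))|\ge 2t(k-1)+2$; (c) if $i\ne j$, then $V(p_i(v))\cap V(p_j(v))=\{v\}$; (d) if $w\in V_{k-1}(G)$ and $w\ne v$,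 then $V(p_i(v))\cap V(p_j(w))=\emptyset$. Let $\iota(k)=\sup\{\iota(G): G\in\mathcal C(k)\}$ and $\iota(k,t)=\sup\{\iota(G): G\in\mathcal C(k,t)\}$. Theorem. For every integer $k\ge 2$ and every integer $t\ge 0$: $\iota(k)\le\frac12$ if and only if $\iota(k,t)\le\frac12$. -/

import Mathlib

namespace CriticalGraph

/-- The chromatic index `χ'(G)`: the least number of colours in a colouring of the edges in which
edges sharing an end vertex get different colours, i.e. the chromatic number of the line graph. -/
noncomputable def chromaticIndex {V : Type*} (G : SimpleGraph V) : ℕ∞ :=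
  G.lineGraph.chromaticNumber

open Classical in
/-- `G` is `k`-critical: a connected finite simple graph with `Δ(G) = k`, `χ'(G) = k + 1` and
`χ'(G - e) = k` for every edge `e`. -/
structure IsCritical {V : Type*} [Fintype V] (G : SimpleGraph V) (k : ℕ) : Prop where
  connected : G.Connected
  maxDegree_eq : G.maxDegree = k
  chromaticIndex_eq : chromaticIndex G = (k + 1 : ℕ)
  chromaticIndex_deleteEdge : ∀ e ∈ G.edgeSet, chromaticIndex (G.deleteEdges {e}) = (k : ℕ)

open Classical in
/-- `V_i(G)`, the set of vertices of degree `i`. -/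
def degreeClass {V : Type*} [Fintype V] (G : SimpleGraph V) (i : ℕ) : Set V :=
  {v | G.degree v = i}

/-- `V(p)`, the set of vertices of a walk `p`. -/
def walkVerts {V : Type*} {G : SimpleGraph V} {u v : V} (p : G.Walk u v) : Set V :=
  {x | x ∈ p.support}

/-- A system of `k - 1` paths `p v i` (`i < k - 1`) starting at each vertex `v` of degree `k - 1`
of `G`; `q v i` is the terminal vertex of `p v i`. The conditions concern only the vertices of
degree `k - 1`; the walks `p v i` for the other vertices `v` play no role. -/
structure IsPathSystem {V : Type*} [Fintype V] (G : SimpleGraph V) (k t : ℕ)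
    (q : V → Fin (k - 1) → V) (p : ∀ (v : V) (i : Fin (k - 1)), G.Walk v (q v i)) : Prop where
  isPath : ∀ v ∈ degreeClass G (k - 1), ∀ i, (p v i).IsPath
  inter_degreeClass : ∀ v ∈ degreeClass G (k - 1), ∀ i,
    walkVerts (p v i) ∩ degreeClass G (k - 1) = {v}
  card_ge : ∀ v ∈ degreeClass G (k - 1), ∀ i, 2 * t * (k - 1) + 2 ≤ (walkVerts (p v i)).ncard
  inter_same : ∀ v ∈ degreeClass G (k - 1), ∀ i j, i ≠ j →
    walkVerts (p v i) ∩ walkVerts (p v j) = {v}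
  inter_other : ∀ v ∈ degreeClass G (k - 1), ∀ w ∈ degreeClass G (k - 1), w ≠ v → ∀ i j,
    walkVerts (p v i) ∩ walkVerts (p w j) = ∅

open Classical in
/-- `G ∈ C(k, t)`. -/
structure MemC {V : Type*} [Fintype V] (G : SimpleGraph V) (k t : ℕ) : Prop where
  isCritical : IsCritical G k
  le_minDegree : k - 1 ≤ G.minDegree
  exists_paths : ∃ (q : V → Fin (k - 1) → V) (p : ∀ (v : V) (i : Fin (k - 1)), G.Walk v (q v i)),
    IsPathSystem G k t q p

/-- The independence ratio `ι(G) = α(G) / |V(G)|`. -/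
noncomputable def indepRatio {V : Type*} [Fintype V] (G : SimpleGraph V) : ℝ :=
  (G.indepNum : ℝ) / (Fintype.card V : ℝ)

/-- The set `{ι(G) : G ∈ C(k)}`. -/
def ratioSet (k : ℕ) : Set ℝ :=
  {r | ∃ (V : Type) (_ : Fintype V) (G : SimpleGraph V), IsCritical G k ∧ indepRatio G = r}

/-- The set `{ι(G) : G ∈ C(k, t)}`. -/
def ratioSetC (k t : ℕ) : Set ℝ :=
  {r | ∃ (V : Type) (_ : Fintype V) (G : SimpleGraph V), MemC G k t ∧ indepRatio G = r}

theorem indepRatio_le_one {V : Type*} [Fintype V] (G : SimpleGraph V) : indepRatio G ≤ 1 := by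
  obtain ⟨s, hs⟩ := G.exists_isNIndepSet_indepNum
  have h : G.indepNum ≤ Fintype.card V := hs.card_eq ▸ s.card_le_univ
  exact div_le_one_of_le₀ (by exact_mod_cast h) (by positivity)

theorem bddAbove_ratioSet (k : ℕ) : BddAbove (ratioSet k) :=
  ⟨1, by rintro _ ⟨V, _, G, -, rfl⟩; exact indepRatio_le_one G⟩

theorem bddAbove_ratioSetC (k t : ℕ) : BddAbove (ratioSetC k t) :=
  ⟨1, by rintro _ ⟨V, _, G, -, rfl⟩; exact indepRatio_le_one G⟩

/-- `ι(k) = sup {ι(G) : G ∈ C(k)}`; the set is bounded above by `1`. -/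
noncomputable def iota (k : ℕ) : ℝ := sSup (ratioSet k)

/-- `ι(k, t) = sup {ι(G) : G ∈ C(k, t)}`; the set is bounded above by `1`. -/
noncomputable def iotaC (k t : ℕ) : ℝ := sSup (ratioSetC k t)

end CriticalGraph

/-!
A critical graph with independence ratio greater than `1/2` is turned into one in `C(k, t)` by
repeated Meredith extension: every vertex `v` is replaced by a copy of `K_{k,k-1}`, with sides `A` of
size `k` and `B` of size `k - 1`, and the edges at `v` are attached to distinct vertices of `A`, the
ports of `v`.

The extension is `k`-critical again (`IsCritical.meredith`). In a colouring with `k` colours, each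
colour class covers all of `B` and hence all but one vertex of `A`, so the edges leaving a copy have
distinct colours and colour `G` (`exists_isEdgeColoring_of_meredith`). Conversely, distinct colours
of the edges leaving a copy extend to the copy by a cyclic Latin square, which settles the deletion of
an edge between copies. If an edge inside the copy of `v` is deleted, `G - vw` is coloured for a
suitable neighbour `w`, and `vw` gets a colour missing at `w`; this colour then occurs twice at `v`,
and the deleted edge leaves room for exactly this repetition (`exists_avoiding_of_deleted`).

Taking the side `A` for the vertices in an independent set of `G` and the side `B` for all others
gives `α ≥ (k - 1) |V| + α(G)` for the extension, on `(2k - 1) |V|` vertices. So a ratio greater than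
`1/2` stays so (`half_lt_indepRatio_meredith`).

Only vertices of `A` that are not ports have degree `k - 1`, all others have degree `k`. Once
`δ ≥ k - 1`, each copy contains at most one vertex of degree `k - 1`, and the copies of vertices of
degree `k` contain none. Hence a system of paths in `G` lifts to a system of longer paths, in which
the `k - 1` paths from one vertex start through the different vertices of `B`
(`HasPathSystem.meredith_degreeClass`). Iteration, beginning with one-vertex paths, makes the paths
as long as desired.
-/

namespace CriticalGraph

open SimpleGraph

/-! ### Proper edge-colourings -/

/-- `c` is a proper edge-colouring of `G`. The colour of an edge `uv` is recorded as `c u v = c v u`;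
the values of `c` at non-adjacent pairs play no role. -/
structure IsEdgeColoring {V C : Type*} (G : SimpleGraph V) (c : V → V → C) : Prop where
  symm : ∀ u v, G.Adj u v → c u v = c v u
  inj : ∀ u v w, G.Adj u v → G.Adj u w → c u v = c u w → v = w

theorem lineGraph_colorable_iff {V : Type*} (G : SimpleGraph V) (n : ℕ) (hn : 0 < n) :
    G.lineGraph.Colorable n ↔ ∃ c : V → V → Fin n, IsEdgeColoring G c := by
  classical
  constructor
  · rintro ⟨f⟩
    refine ⟨fun u v => if h : G.Adj u v then f ⟨s(u, v), h⟩ else ⟨0, hn⟩, ?_, ?_⟩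
    · intro u v h
      simp only [h, h.symm, dif_pos]
      congr 2
      exact Sym2.eq_swap
    · intro u v w hv hw h
      simp only [hv, hw, dif_pos] at h
      by_contra hvw
      refine f.valid (v := ⟨s(u, v), hv⟩) (w := ⟨s(u, w), hw⟩) ⟨?_, u, by simp⟩ h
      intro he
      have := congrArg Subtype.val he
      simp only [Sym2.congr_right] at this
      exact hvw this
  · rintro ⟨c, hc⟩
    have key : ∀ e : G.edgeSet, ∃ x : Fin n, ∀ u v, e.1 = s(u, v) → c u v = x := by
      rintro ⟨⟨a, b⟩, h⟩
      refine ⟨c a b, fun u v huv => ?_⟩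
      rcases Sym2.eq_iff.1 huv with ⟨rfl, rfl⟩ | ⟨rfl, rfl⟩
      · rfl
      · exact (hc.symm _ _ h).symm
    choose f hf using key
    refine ⟨Coloring.mk f ?_⟩
    rintro ⟨e, he⟩ ⟨e', he'⟩ ⟨hne, u, hu, hu'⟩ hcol
    obtain ⟨v, rfl⟩ := Sym2.mem_iff_exists.1 hu
    obtain ⟨w, rfl⟩ := Sym2.mem_iff_exists.1 hu'
    rw [← hf ⟨s(u, v), he⟩ u v rfl, ← hf ⟨s(u, w), he'⟩ u w rfl] at hcol
    apply hne
    have := hc.inj u v w he he' hcol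
    subst this
    rfl

open Classical in
/-- A vertex `w` of degree at most the number of colours misses a colour once an edge at `w` is
deleted. -/
theorem exists_missing_colour {V C : Type*} [Fintype V] [Fintype C] (G : SimpleGraph V)
    (c : V → V → C) (v w : V) (hvw : G.Adj v w) (hdeg : G.degree w ≤ Fintype.card C) :
    ∃ x : C, ∀ u, (G.deleteEdges {s(v, w)}).Adj w u → c w u ≠ x := by
  have h1 : (((G.neighborFinset w).erase v).image (c w)).card < (Finset.univ : Finset C).card := by
    refine lt_of_le_of_lt Finset.card_image_le ?_
    have hv : v ∈ G.neighborFinset w := by simpa using hvw.symm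
    rw [Finset.card_univ]
    refine lt_of_lt_of_le (Finset.card_erase_lt_of_mem hv) ?_
    simpa using hdeg
  obtain ⟨x, -, hx⟩ := Finset.exists_mem_notMem_of_card_lt_card h1
  refine ⟨x, fun u hu hcx => hx ?_⟩
  rw [deleteEdges_adj] at hu
  refine Finset.mem_image.2 ⟨u, Finset.mem_erase.2 ⟨?_, by simpa using hu.1⟩, hcx⟩
  rintro rfl
  exact hu.2 (by simp [Sym2.eq_swap])

/-! ### Colourings of `K_{k,k-1}` -/

/-- A proper edge-colouring `c` of the complete bipartite graph with sides `A` and `B` in which the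
colour `f a` does not occur at the vertex `a`. -/
structure IsAvoidingColoring {A B C : Type*} (f : A → C) (c : A → B → C) : Prop where
  row : ∀ a, Function.Injective (c a)
  col : ∀ b, Function.Injective fun a => c a b
  avoid : ∀ a b, c a b ≠ f a

/-- The cyclic Latin square: identify `A` with `ZMod k` through `e` and `B` with the nonzero
residues through `e'`, and give the edge `ab` the colour of `f` at `e a + e' b`. -/
theorem isAvoidingColoring_cyclic {A B C : Type*} {k : ℕ} (f : A ≃ C) (e : A ≃ ZMod k)
    (e' : B ≃ {j : ZMod k // j ≠ 0}) :
    IsAvoidingColoring f (fun a b => f (e.symm (e a + (e' b).1))) := by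
  refine ⟨fun a b b' h => ?_, fun b a a' h => ?_, fun a b h => ?_⟩
  · simpa [Subtype.val_inj] using h
  · simpa using h
  · rw [f.apply_eq_iff_eq, Equiv.symm_apply_eq] at h
    exact (e' b).2 (by simpa using h)

section Bipartite

variable {A B C : Type*} [Fintype A] [Fintype B]

theorem exists_equiv_extend [Fintype C] (hAC : Fintype.card A = Fintype.card C) {P : Set A}
    {e : A → C} (he : Set.InjOn e P) : ∃ f : A ≃ C, ∀ a ∈ P, f a = e a := by
  classical
  obtain ⟨g, hg⟩ := Set.MapsTo.exists_equiv_extend_of_card_eq (t := (Finset.univ : Finset C))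
    (by simpa using hAC) (s := P) (f := e) (fun _ _ => by simp) he
  exact ⟨g.trans (Equiv.subtypeUnivEquiv (by simp)), fun a ha => hg a ha⟩

theorem card_eq_card_ne_zero [NeZero (Fintype.card A)]
    (hBA : Fintype.card B + 1 = Fintype.card A) :
    Fintype.card B = Fintype.card {j : ZMod (Fintype.card A) // j ≠ 0} := by
  classical
  rw [Fintype.card_subtype_compl]
  simp [ZMod.card, ← hBA]

theorem exists_equiv_ne_zero [NeZero (Fintype.card A)] (hBA : Fintype.card B + 1 = Fintype.card A)
    (b : B) {d : ZMod (Fintype.card A)} (hd : d ≠ 0) :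
    ∃ e' : B ≃ {j : ZMod (Fintype.card A) // j ≠ 0}, (e' b).1 = d := by
  obtain ⟨g, hg⟩ := exists_equiv_extend (card_eq_card_ne_zero hBA) (P := {b})
    (e := fun _ => ⟨d, hd⟩) (by simp)
  exact ⟨g, by rw [hg b rfl]⟩

theorem exists_avoiding_of_ne (hBA : Fintype.card B + 1 = Fintype.card A) (f : A ≃ C) (b : B)
    {a₁ a₂ : A} (h : a₁ ≠ a₂) :
    ∃ c : A → B → C, IsAvoidingColoring f c ∧ c a₁ b = f a₂ := by
  have : NeZero (Fintype.card A) := ⟨by omega⟩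
  obtain ⟨e, -⟩ := exists_equiv_extend (A := A) (C := ZMod (Fintype.card A)) (by simp [ZMod.card])
    (P := ∅) (e := fun _ => 0) (by simp)
  obtain ⟨e', he'⟩ := exists_equiv_ne_zero hBA b (d := e a₂ - e a₁)
    (by simpa [sub_eq_zero] using h.symm)
  exact ⟨_, isAvoidingColoring_cyclic f e e', by simp [he']⟩

theorem exists_avoiding_of_distinct (hBA : Fintype.card B + 1 = Fintype.card A) (f : A ≃ C) (b : B)
    {a₀ a₁ a₂ : A} (h₀₁ : a₀ ≠ a₁) (h₀₂ : a₀ ≠ a₂) (h₁₂ : a₁ ≠ a₂) :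
    ∃ c : A → B → C, IsAvoidingColoring f c ∧ c a₀ b = f a₁ ∧ c a₁ b = f a₂ := by
  classical
  have h3 : 2 < Fintype.card A := Fintype.two_lt_card_iff.2 ⟨a₀, a₁, a₂, h₀₁, h₀₂, h₁₂⟩
  have : NeZero (Fintype.card A) := ⟨by omega⟩
  have : Fact (1 < Fintype.card A) := ⟨by omega⟩
  have h2 : (2 : ZMod (Fintype.card A)) ≠ 0 := by
    intro h
    have := (ZMod.natCast_eq_zero_iff 2 (Fintype.card A)).1 (by exact_mod_cast h)
    exact absurd (Nat.le_of_dvd (by norm_num) this) (by omega)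
  have h21 : (2 : ZMod (Fintype.card A)) ≠ 1 := by
    intro h
    have h' : (1 : ZMod (Fintype.card A)) + 1 = 1 := by rw [one_add_one_eq_two, h]
    simp at h'
  obtain ⟨e, he⟩ := exists_equiv_extend (A := A) (C := ZMod (Fintype.card A)) (by simp [ZMod.card])
    (P := {a₀, a₁, a₂}) (e := fun a => if a = a₀ then 0 else if a = a₁ then 1 else 2) (by
      intro x hx y hy hxy
      simp only [Set.mem_insert_iff, Set.mem_singleton_iff] at hx hy
      rcases hx with rfl | rfl | rfl <;> rcases hy with rfl | rfl | rfl <;>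
        simp_all [eq_comm])
  have e0 : e a₀ = 0 := by rw [he _ (by simp)]; simp
  have e1 : e a₁ = 1 := by rw [he _ (by simp)]; simp [h₀₁.symm]
  have e2 : e a₂ = 2 := by rw [he _ (by simp)]; simp [h₀₂.symm, h₁₂.symm]
  obtain ⟨e', he'⟩ := exists_equiv_ne_zero hBA b (d := 1) one_ne_zero
  refine ⟨_, isAvoidingColoring_cyclic f e e', ?_, ?_⟩
  · simp [he', e0, Equiv.symm_apply_eq, e1]
  · simp [he', e1, Equiv.symm_apply_eq, e2, one_add_one_eq_two]

theorem exists_avoiding_of_injOn [Fintype C] (hBA : Fintype.card B + 1 = Fintype.card A)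
    (hAC : Fintype.card A = Fintype.card C) {P : Set A} {e : A → C} (he : Set.InjOn e P) :
    ∃ c : A → B → C, (∀ a, Function.Injective (c a)) ∧ (∀ b, Function.Injective fun a => c a b) ∧
      ∀ a ∈ P, ∀ b, c a b ≠ e a := by
  obtain ⟨f, hf⟩ := exists_equiv_extend hAC he
  have : NeZero (Fintype.card A) := ⟨by omega⟩
  obtain ⟨g, -⟩ := exists_equiv_extend (A := A) (C := ZMod (Fintype.card A)) (by simp [ZMod.card])
    (P := ∅) (e := fun _ => 0) (by simp)
  have hc := isAvoidingColoring_cyclic f g (Fintype.equivOfCardEq (card_eq_card_ne_zero hBA))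
  exact ⟨_, hc.row, hc.col, fun a ha b => hf a ha ▸ hc.avoid a b⟩

/-- Deleting the edge `a₀b₀` of `K_{k,k-1}` makes room for one repetition `e a₁ = e a₂` among the
colours `e a`, `a ∈ P`, of the pendant edges attached on the side `A`, provided that `a₁ = a₀` is an
end of the deleted edge or that no pendant edge is attached at `a₀`. -/
theorem exists_avoiding_of_deleted [Fintype C] (hBA : Fintype.card B + 1 = Fintype.card A)
    (hAC : Fintype.card A = Fintype.card C) {P : Set A} {e : A → C} {a₀ a₁ a₂ : A} (b₀ : B)
    (h₂ : a₂ ∈ P) (h₁₂ : a₁ ≠ a₂) (he : Set.InjOn e (P \ {a₁})) (heq : e a₁ = e a₂)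
    (h₀ : a₀ ∉ P ∨ a₀ = a₁) :
    ∃ c : A → B → C,
      (∀ a b b', ¬ (a = a₀ ∧ b = b₀) → ¬ (a = a₀ ∧ b' = b₀) → c a b = c a b' → b = b') ∧
      (∀ a a' b, ¬ (a = a₀ ∧ b = b₀) → ¬ (a' = a₀ ∧ b = b₀) → c a b = c a' b → a = a') ∧
      ∀ a ∈ P, ∀ b, ¬ (a = a₀ ∧ b = b₀) → c a b ≠ e a := by
  classical
  obtain ⟨f, hf⟩ := exists_equiv_extend hAC he
  have hf2 : f a₂ = e a₂ := hf a₂ ⟨h₂, fun h => h₁₂ h.symm⟩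
  by_cases h01 : a₀ = a₁
  · -- The deleted edge `a₁b₀` is given the colour `e a₁`.
    subst h01
    obtain ⟨c, hc, hcb⟩ := exists_avoiding_of_ne hBA f b₀ h₁₂
    refine ⟨c, fun a b b' _ _ h => hc.row a h, fun a a' b _ _ h => hc.col b h, ?_⟩
    intro a ha b hab
    by_cases haa : a = a₀
    · subst haa
      rw [heq, ← hf2, ← hcb]
      exact fun h => hab ⟨rfl, hc.row _ h⟩
    · rw [← hf a ⟨ha, haa⟩]
      exact hc.avoid a b
  · -- The colours of `a₀b₀` and `a₁b₀` are chosen as `f a₁` and `e a₁`.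
    have h0P : a₀ ∉ P := h₀.resolve_right h01
    have h02 : a₀ ≠ a₂ := fun h => h0P (h ▸ h₂)
    obtain ⟨c, hc, hc0, hc1⟩ := exists_avoiding_of_distinct hBA f b₀ h01 h02 h₁₂
    -- Exchange the colours along the path `a₁ b₀ a₀`, cut at the deleted edge: only `a₁b₀` changes.
    refine ⟨fun a b => if a = a₁ ∧ b = b₀ then f a₁ else c a b, ?_, ?_, ?_⟩
    · intro a b b' h h' hcc
      by_cases ha : a = a₁
      · subst ha
        by_cases hb : b = b₀ <;> by_cases hb' : b' = b₀
        · rw [hb, hb']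
        · simp only [hb, hb', and_true, and_false, if_true, if_false] at hcc
          exact absurd hcc.symm (hc.avoid _ _)
        · simp only [hb, hb', and_true, and_false, if_true, if_false] at hcc
          exact absurd hcc (hc.avoid _ _)
        · simp only [hb, hb', and_false, if_false] at hcc
          exact hc.row _ hcc
      · simp only [ha, false_and, if_false] at hcc
        exact hc.row _ hcc
    · intro a a' b h h' hcc
      by_cases hb : b = b₀
      · subst hb
        simp only [and_true] at h h' hcc
        by_cases ha : a = a₁ <;> by_cases ha' : a' = a₁
        · rw [ha, ha']
        · simp only [ha, ha', if_true, if_false, ← hc0] at hcc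
          exact absurd (hc.col _ hcc).symm h'
        · simp only [ha, ha', if_true, if_false, ← hc0] at hcc
          exact absurd (hc.col _ hcc) h
        · simp only [ha, ha', if_false] at hcc
          exact hc.col _ hcc
      · simp only [hb, and_false, if_false] at hcc
        exact hc.col _ hcc
    · intro a ha b hab
      by_cases ha1 : a = a₁
      · subst ha1
        rw [heq, ← hf2]
        by_cases hb : b = b₀
        · simp only [hb, and_true, if_true]
          exact fun h => h₁₂ (f.injective h)
        · simp only [hb, and_false, if_false, ← hc1]
          exact fun h => hb (hc.row _ h)
      · simp only [ha1, false_and, if_false]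
        rw [← hf a ⟨ha, ha1⟩]
        exact hc.avoid a b

end Bipartite

/-! ### The Meredith extension -/

/-- The Meredith extension of `G`: every vertex `v` is replaced by a copy of the complete bipartite
graph with sides `A` and `B`, and every edge `uv` by an edge between the vertices `π u v` and
`π v u` of the sides `A` of the copies of `u` and `v`. The vertex `π u v` is called the port of `u`
towards `v`; distinct neighbours are meant to have distinct ports. -/
def meredith {V A B : Type*} (G : SimpleGraph V) (π : V → V → A) : SimpleGraph (V × (A ⊕ B)) where
  Adj x y :=
    match x, y with
    | (u, .inl a), (v, .inl a') => G.Adj u v ∧ a = π u v ∧ a' = π v u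
    | (u, .inl _), (v, .inr _) => u = v
    | (u, .inr _), (v, .inl _) => u = v
    | (_, .inr _), (_, .inr _) => False
  symm := ⟨by
    rintro ⟨u, a | b⟩ ⟨v, a' | b'⟩ h
    · exact ⟨h.1.symm, h.2.2, h.2.1⟩
    · exact Eq.symm h
    · exact Eq.symm h
    · exact h⟩
  loopless := ⟨by
    rintro ⟨u, a | b⟩ h
    · exact G.irrefl h.1
    · exact h⟩

section Meredith

variable {V A B C : Type*} {G : SimpleGraph V} {π : V → V → A}

@[simp] theorem meredith_inl_inl {u v : V} {a a' : A} :
    (meredith (B := B) G π).Adj (u, .inl a) (v, .inl a') ↔ G.Adj u v ∧ a = π u v ∧ a' = π v u :=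
  Iff.rfl

@[simp] theorem meredith_inl_inr {u v : V} {a : A} {b : B} :
    (meredith G π).Adj (u, .inl a) (v, .inr b) ↔ u = v := Iff.rfl

@[simp] theorem meredith_inr_inl {u v : V} {a : A} {b : B} :
    (meredith G π).Adj (u, .inr b) (v, .inl a) ↔ u = v := Iff.rfl

@[simp] theorem meredith_inr_inr {u v : V} {b b' : B} :
    ¬ (meredith G π).Adj (u, .inr b) (v, .inr b') := id

/-- A proper edge-colouring of a subgraph of the Meredith extension is put together from colours
`x u v` of the edges between copies and colours `c u a b` of the edges inside the copies. -/
theorem exists_isEdgeColoring_of_le_meredith (hπ : ∀ v, Set.InjOn (π v) (G.neighborSet v))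
    {H : SimpleGraph (V × (A ⊕ B))} (hH : H ≤ meredith G π) (x : V → V → C) (c : V → A → B → C)
    (hx : ∀ u v, H.Adj (u, .inl (π u v)) (v, .inl (π v u)) → x u v = x v u)
    (hrow : ∀ u a b b', H.Adj (u, .inl a) (u, .inr b) → H.Adj (u, .inl a) (u, .inr b') →
      c u a b = c u a b' → b = b')
    (hcol : ∀ u a a' b, H.Adj (u, .inl a) (u, .inr b) → H.Adj (u, .inl a') (u, .inr b) →
      c u a b = c u a' b → a = a')
    (havoid : ∀ u v b, H.Adj (u, .inl (π u v)) (v, .inl (π v u)) →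
      H.Adj (u, .inl (π u v)) (u, .inr b) → c u (π u v) b ≠ x u v) :
    ∃ col : V × (A ⊕ B) → V × (A ⊕ B) → C, IsEdgeColoring H col := by
  refine ⟨fun p q => match p, q with
    | (u, .inl _), (v, .inl _) => x u v
    | (u, .inl a), (_, .inr b) => c u a b
    | (u, .inr b), (_, .inl a) => c u a b
    | (u, .inr _), (v, .inr _) => x u v, ?_, ?_⟩
  · rintro ⟨u, a | b⟩ ⟨v, a' | b'⟩ h
    · obtain ⟨-, rfl, rfl⟩ := hH h
      exact hx u v h
    · obtain rfl : u = v := hH h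
      rfl
    · obtain rfl : u = v := hH h
      rfl
    · exact (hH h).elim
  · rintro ⟨u, a | b⟩ ⟨v, a₁ | b₁⟩ ⟨w, a₂ | b₂⟩ h₁ h₂ he
    · obtain ⟨h₁', rfl, rfl⟩ := hH h₁
      obtain ⟨h₂', h, rfl⟩ := hH h₂
      obtain rfl := hπ u h₁' h₂' h
      rfl
    · obtain ⟨h₁', rfl, rfl⟩ := hH h₁
      obtain rfl : u = w := hH h₂
      exact absurd he.symm (havoid _ _ _ h₁ h₂)
    · obtain ⟨h₂', rfl, rfl⟩ := hH h₂
      obtain rfl : u = v := hH h₁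
      exact absurd he (havoid _ _ _ h₂ h₁)
    · obtain rfl : u = v := hH h₁
      obtain rfl : u = w := hH h₂
      rw [hrow _ _ _ _ h₁ h₂ he]
    · obtain rfl : u = v := hH h₁
      obtain rfl : u = w := hH h₂
      rw [hcol _ _ _ _ h₁.symm h₂.symm he]
    · exact (hH h₂).elim
    · exact (hH h₁).elim
    · exact (hH h₁).elim

/-- Every vertex of the side `B` of a copy sees all colours, so a colour class covers all of `B` and
all but one vertex of `A`: no colour occurs twice among the edges leaving the copy. -/
theorem exists_isEdgeColoring_of_meredith [Fintype A] [Fintype B] [Fintype C]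
    (hBA : Fintype.card B + 1 = Fintype.card A) (hAC : Fintype.card A = Fintype.card C)
    (hπ : ∀ v, Set.InjOn (π v) (G.neighborSet v))
    {col : V × (A ⊕ B) → V × (A ⊕ B) → C} (hc : IsEdgeColoring (meredith G π) col) :
    ∃ x : V → V → C, IsEdgeColoring G x := by
  classical
  refine ⟨fun u v => col (u, .inl (π u v)) (v, .inl (π v u)), ?_, ?_⟩
  · intro u v h
    exact hc.symm _ _ ⟨h, rfl, rfl⟩
  · intro u v w hv hw he
    by_contra hvw
    have hsurj : ∀ b : B, ∃ a : A,
        col (u, .inr b) (u, .inl a) = col (u, .inl (π u v)) (v, .inl (π v u)) := by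
      intro b
      have hinj : Function.Injective fun a : A => col (u, .inr b) (u, .inl a) := by
        intro a a' h
        have := hc.inj (u, .inr b) (u, .inl a) (u, .inl a') rfl rfl h
        simpa using this
      exact ((Fintype.bijective_iff_injective_and_card _).2 ⟨hinj, hAC⟩).surjective _
    choose m hm using hsurj
    have hminj : Function.Injective m := by
      intro b b' h
      have h' := (hm b).trans (hm b').symm
      rw [← h, hc.symm (u, .inr b) (u, .inl (m b)) rfl,
        hc.symm (u, .inr b') (u, .inl (m b)) rfl] at h'
      simpa using hc.inj (u, .inl (m b)) (u, .inr b) (u, .inr b') rfl rfl h'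
    have hv' : ∀ b, m b ≠ π u v := by
      intro b h
      have h' := hm b
      rw [hc.symm (u, .inr b) (u, .inl (m b)) rfl, h] at h'
      have := hc.inj (u, .inl (π u v)) (u, .inr b) (v, .inl (π v u)) rfl ⟨hv, rfl, rfl⟩ h'
      simp at this
    have hw' : ∀ b, m b ≠ π u w := by
      intro b h
      have h' := (hm b).trans he
      rw [hc.symm (u, .inr b) (u, .inl (m b)) rfl, h] at h'
      have := hc.inj (u, .inl (π u w)) (u, .inr b) (w, .inl (π w u)) rfl ⟨hw, rfl, rfl⟩ h'
      simp at this
    have hport : π u v ≠ π u w := fun h => hvw (hπ u hv hw h)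
    have hsub : Finset.univ.image m ⊆ (Finset.univ.erase (π u v)).erase (π u w) := by
      intro a ha
      obtain ⟨b, -, rfl⟩ := Finset.mem_image.1 ha
      simp [hv' b, hw' b]
    have := Finset.card_le_card hsub
    rw [Finset.card_image_of_injective _ hminj,
      Finset.card_erase_of_mem (by simp [hport.symm]), Finset.card_erase_of_mem (by simp),
      Finset.card_univ, Finset.card_univ] at this
    have h2 : 2 ≤ Fintype.card A := Fintype.one_lt_card_iff.2 ⟨_, _, hport⟩
    omega

open Classical in
/-- If `G` is not edge-colourable but `G - vw` is, then some colouring of all edges of `G` has as its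
only defect that the colour of `vw` occurs on a second edge at `v`. -/
theorem exists_coloring_with_one_repetition [Fintype V] [Fintype C]
    (hdeg : ∀ v, G.degree v ≤ Fintype.card C)
    (hnot : ¬ ∃ x : V → V → C, IsEdgeColoring G x) {v w : V} (hvw : G.Adj v w)
    (hdel : ∃ x : V → V → C, IsEdgeColoring (G.deleteEdges {s(v, w)}) x) :
    ∃ x : V → V → C, (∀ u y, G.Adj u y → x u y = x y u) ∧
      (∀ u y z, u ≠ v → G.Adj u y → G.Adj u z → x u y = x u z → y = z) ∧
      (∀ y z, y ≠ w → z ≠ w → G.Adj v y → G.Adj v z → x v y = x v z → y = z) ∧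
      ∃ y, G.Adj v y ∧ y ≠ w ∧ x v w = x v y := by
  obtain ⟨x₀, hx₀⟩ := hdel
  obtain ⟨m, hm⟩ := exists_missing_colour G x₀ v w hvw (hdeg w)
  have hadj : ∀ {u y}, G.Adj u y → ¬ (u = v ∧ y = w) → ¬ (u = w ∧ y = v) →
      (G.deleteEdges {s(v, w)}).Adj u y := by
    intro u y h h1 h2
    rw [deleteEdges_adj]
    refine ⟨h, fun h' => ?_⟩
    rcases Sym2.eq_iff.1 (Set.mem_singleton_iff.1 h') with h' | h'
    · exact h1 h'
    · exact h2 h'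
  have hne : v ≠ w := hvw.ne
  set x : V → V → C := fun u y => if (u = v ∧ y = w) ∨ (u = w ∧ y = v) then m else x₀ u y with hx
  have hsymm : ∀ u y, G.Adj u y → x u y = x y u := by
    intro u y h
    by_cases h1 : u = v ∧ y = w
    · simp [hx, h1]
    by_cases h2 : u = w ∧ y = v
    · simp [hx, h2]
    have h3 : ¬ (y = v ∧ u = w) := fun h => h2 h.symm
    have h4 : ¬ (y = w ∧ u = v) := fun h => h1 h.symm
    simp only [hx, h1, h2, h3, h4, or_self, if_false]
    exact hx₀.symm _ _ (hadj h h1 h2)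
  have hinj : ∀ u y z, u ≠ v → G.Adj u y → G.Adj u z → x u y = x u z → y = z := by
    intro u y z hu hy hz h
    by_cases huw : u = w
    · subst huw
      simp only [hx, hu, false_and, false_or, true_and] at h
      by_cases hyv : y = v <;> by_cases hzv : z = v
      · rw [hyv, hzv]
      · simp only [hyv, hzv, if_true, if_false] at h
        exact absurd h.symm (hm z (hadj hz (by simp [hu]) (by simp [hzv])))
      · simp only [hyv, hzv, if_true, if_false] at h
        exact absurd h (hm y (hadj hy (by simp [hu]) (by simp [hyv])))
      · simp only [hyv, hzv, if_false] at h
        exact hx₀.inj _ _ _ (hadj hy (by simp [hu]) (by simp [hyv]))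
          (hadj hz (by simp [hu]) (by simp [hzv])) h
    · simp only [hx, hu, huw, false_and, or_self, if_false] at h
      exact hx₀.inj _ _ _ (hadj hy (by simp [hu]) (by simp [huw]))
        (hadj hz (by simp [hu]) (by simp [huw])) h
  have hinj' : ∀ y z, y ≠ w → z ≠ w → G.Adj v y → G.Adj v z → x v y = x v z → y = z := by
    intro y z hyw hzw hy hz h
    simp only [hx, hyw, hzw, hne, false_and, and_false, or_self, if_false] at h
    exact hx₀.inj _ _ _ (hadj hy (by simp [hyw]) (by simp [hne]))
      (hadj hz (by simp [hzw]) (by simp [hne])) h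
  refine ⟨x, hsymm, hinj, hinj', ?_⟩
  -- Without a second edge of the colour of `vw` at `v`, the colouring `x` of `G` would be proper.
  by_contra! hrep
  refine hnot ⟨x, hsymm, fun u y z hy hz h => ?_⟩
  by_cases hu : u = v
  · subst hu
    by_cases hyw : y = w <;> by_cases hzw : z = w
    · rw [hyw, hzw]
    · subst hyw
      exact absurd h (hrep z hz hzw)
    · subst hzw
      exact absurd h.symm (hrep y hy hyw)
    · exact hinj' y z hyw hzw hy hz h
  · exact hinj u y z hu hy hz h

open Classical in
/-- All edge-deleted subgraphs of the Meredith extension are edge-colourable if this holds for `G`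
and `G` itself is not edge-colourable. -/
theorem exists_isEdgeColoring_meredith_deleteEdges [Fintype V] [Fintype A] [Fintype B] [Fintype C]
    (hBA : Fintype.card B + 1 = Fintype.card A) (hAC : Fintype.card A = Fintype.card C)
    (hπ : ∀ v, Set.InjOn (π v) (G.neighborSet v))
    (hdeg : ∀ v, G.degree v ≤ Fintype.card C) (hpos : ∀ v, ∃ w, G.Adj v w)
    (hnot : ¬ ∃ x : V → V → C, IsEdgeColoring G x)
    (hdel : ∀ v w, G.Adj v w → ∃ x : V → V → C, IsEdgeColoring (G.deleteEdges {s(v, w)}) x)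
    {e : Sym2 (V × (A ⊕ B))} (he : e ∈ (meredith G π).edgeSet) :
    ∃ col : V × (A ⊕ B) → V × (A ⊕ B) → C,
      IsEdgeColoring ((meredith G π).deleteEdges {e}) col := by
  -- The colours of the edges at `u`, read off at the ports of `u`.
  have hport : ∀ (x : V → V → C) (u : V), ∃ f : A → C, ∀ y, G.Adj u y → f (π u y) = x u y := by
    intro x u
    have : Nonempty V := ⟨u⟩
    exact ⟨fun a => x u (Function.invFunOn (π u) (G.neighborSet u) a), fun y hy =>
      congrArg (x u) ((hπ u).leftInvOn_invFunOn hy)⟩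
  -- The case of an edge between copies.
  have external : ∀ v w, G.Adj v w → ∃ col : V × (A ⊕ B) → V × (A ⊕ B) → C,
      IsEdgeColoring ((meredith G π).deleteEdges
        {s((v, .inl (π v w)), (w, .inl (π w v)))}) col := by
    intro v w hvw
    obtain ⟨x, hx⟩ := hdel v w hvw
    choose f hf using hport x
    have hP : ∀ u, ∃ c : A → B → C, (∀ a, Function.Injective (c a)) ∧
        (∀ b, Function.Injective fun a => c a b) ∧
        ∀ a ∈ π u '' ((G.deleteEdges {s(v, w)}).neighborSet u), ∀ b, c a b ≠ f u a := by
      intro u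
      refine exists_avoiding_of_injOn hBA hAC ?_
      rintro _ ⟨y, hy, rfl⟩ _ ⟨z, hz, rfl⟩ h
      rw [hf u y (deleteEdges_le _ hy), hf u z (deleteEdges_le _ hz)] at h
      rw [hx.inj u y z hy hz h]
    choose c hrow hcol havoid using hP
    have hadj : ∀ u y, ((meredith (B := B) G π).deleteEdges
        {s((v, .inl (π v w)), (w, .inl (π w v)))}).Adj (u, .inl (π u y)) (y, .inl (π y u)) →
        (G.deleteEdges {s(v, w)}).Adj u y := by
      intro u y h
      rw [deleteEdges_adj] at h ⊢
      refine ⟨h.1.1, fun h' => h.2 ?_⟩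
      rcases Sym2.eq_iff.1 (Set.mem_singleton_iff.1 h') with ⟨rfl, rfl⟩ | ⟨rfl, rfl⟩
      · rfl
      · exact Sym2.eq_swap
    refine exists_isEdgeColoring_of_le_meredith hπ (deleteEdges_le _) x c ?_ ?_ ?_ ?_
    · exact fun u y h => hx.symm _ _ (hadj u y h)
    · exact fun u a b b' _ _ h => hrow u a h
    · exact fun u a a' b _ _ h => hcol u b h
    · intro u y b h _
      rw [← hf u y (deleteEdges_le _ (hadj u y h))]
      exact havoid u _ ⟨y, hadj u y h, rfl⟩ b
  -- The case of an edge inside a copy.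
  have internal : ∀ v a b, ∃ col : V × (A ⊕ B) → V × (A ⊕ B) → C,
      IsEdgeColoring ((meredith G π).deleteEdges {s((v, .inl a), (v, .inr b))}) col := by
    intro v a₀ b₀
    obtain ⟨w, hvw, hw⟩ : ∃ w, G.Adj v w ∧ (a₀ ∉ π v '' G.neighborSet v ∨ a₀ = π v w) := by
      by_cases h : a₀ ∈ π v '' G.neighborSet v
      · obtain ⟨w, hw, rfl⟩ := h
        exact ⟨w, hw, Or.inr rfl⟩
      · obtain ⟨w, hw⟩ := hpos v
        exact ⟨w, hw, Or.inl h⟩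
    obtain ⟨x, hsymm, hinj, hinj', y, hvy, hyw, hxy⟩ :=
      exists_coloring_with_one_repetition hdeg hnot hvw (hdel v w hvw)
    choose f hf using hport x
    have hP : ∀ u, ∃ c : A → B → C,
        (∀ a b b', ¬ (u = v ∧ a = a₀ ∧ b = b₀) → ¬ (u = v ∧ a = a₀ ∧ b' = b₀) →
          c a b = c a b' → b = b') ∧
        (∀ a a' b, ¬ (u = v ∧ a = a₀ ∧ b = b₀) → ¬ (u = v ∧ a' = a₀ ∧ b = b₀) →
          c a b = c a' b → a = a') ∧
        ∀ a ∈ π u '' G.neighborSet u, ∀ b, ¬ (u = v ∧ a = a₀ ∧ b = b₀) → c a b ≠ f u a := by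
      intro u
      by_cases hu : u = v
      · subst hu
        simp only [true_and]
        refine exists_avoiding_of_deleted hBA hAC b₀ (a₁ := π u w) (a₂ := π u y) ⟨y, hvy, rfl⟩
          (fun h => hyw (hπ u hvw hvy h).symm) ?_ ?_ hw
        · rintro _ ⟨⟨p, hp, rfl⟩, hpw⟩ _ ⟨⟨q, hq, rfl⟩, hqw⟩ h
          rw [hf u p hp, hf u q hq] at h
          rw [hinj' p q (fun h => hpw (by rw [h]; rfl)) (fun h => hqw (by rw [h]; rfl)) hp hq h]
        · rw [hf u w hvw, hf u y hvy, hxy]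
      · obtain ⟨c, hrow, hcol, havoid⟩ := exists_avoiding_of_injOn hBA hAC (e := f u)
          (P := π u '' G.neighborSet u) (by
            rintro _ ⟨p, hp, rfl⟩ _ ⟨q, hq, rfl⟩ h
            rw [hf u p hp, hf u q hq] at h
            rw [hinj u p q hu hp hq h])
        exact ⟨c, fun a b b' _ _ h => hrow a h, fun a a' b _ _ h => hcol b h,
          fun a ha b _ => havoid a ha b⟩
    choose c hrow hcol havoid using hP
    have hadj : ∀ u a b, ((meredith G π).deleteEdges
        {s((v, .inl a₀), (v, .inr b₀))}).Adj (u, .inl a) (u, .inr b) →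
        ¬ (u = v ∧ a = a₀ ∧ b = b₀) := by
      rintro u a b h ⟨rfl, rfl, rfl⟩
      rw [deleteEdges_adj] at h
      exact h.2 rfl
    refine exists_isEdgeColoring_of_le_meredith hπ (deleteEdges_le _) x c ?_ ?_ ?_ ?_
    · exact fun u y h => hsymm _ _ (deleteEdges_le _ h).1
    · exact fun u a b b' h h' => hrow u a b b' (hadj _ _ _ h) (hadj _ _ _ h')
    · exact fun u a a' b h h' => hcol u a a' b (hadj _ _ _ h) (hadj _ _ _ h')
    · intro u z b h h'
      have huz : G.Adj u z := (deleteEdges_le _ h).1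
      rw [← hf u z huz]
      exact havoid u _ ⟨z, huz, rfl⟩ b (hadj _ _ _ h')
  induction e using Sym2.ind with
  | _ p q =>
    obtain ⟨u, a | b⟩ := p <;> obtain ⟨v, a' | b'⟩ := q
    · obtain ⟨h, rfl, rfl⟩ := he
      exact external u v h
    · obtain rfl : u = v := he
      exact internal u a b'
    · obtain rfl : u = v := he
      rw [Sym2.eq_swap]
      exact internal u a' b
    · exact he.elim

theorem meredith_connected [Nonempty A] [Nonempty B] (hG : G.Connected) :
    (meredith (B := B) G π).Connected := by
  have hcopy : ∀ (v : V) (s t : A ⊕ B), (meredith G π).Reachable (v, s) (v, t) := by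
    obtain ⟨a₀⟩ := ‹Nonempty A›
    obtain ⟨b₀⟩ := ‹Nonempty B›
    intro v
    have h : ∀ s : A ⊕ B, (meredith G π).Reachable (v, s) (v, .inl a₀) := by
      rintro (a | b)
      · exact (show (meredith G π).Adj (v, .inl a) (v, .inr b₀) from rfl).reachable.trans
          (show (meredith G π).Adj (v, .inr b₀) (v, .inl a₀) from rfl).reachable
      · exact (show (meredith G π).Adj (v, .inr b) (v, .inl a₀) from rfl).reachable
    exact fun s t => (h s).trans (h t).symm
  have hwalk : ∀ {u v : V} (_ : G.Walk u v) (s t : A ⊕ B),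
      (meredith G π).Reachable (u, s) (v, t) := by
    intro u v p
    induction p with
    | nil => exact hcopy _
    | cons h p ih =>
      intro s t
      exact (hcopy _ _ _).trans ((show (meredith G π).Adj (_, .inl (π _ _)) (_, .inl (π _ _)) from
        ⟨h, rfl, rfl⟩).reachable.trans (ih _ t))
  have : Nonempty V := hG.nonempty
  refine ⟨?_⟩
  rintro ⟨u, s⟩ ⟨v, t⟩
  exact (hG.preconnected u v).elim fun p => hwalk p s t

open Classical in
theorem meredith_degree_inr [Fintype V] [Fintype A] [Fintype B] (v : V) (b : B) :
    (meredith G π).degree (v, .inr b) = Fintype.card A := by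
  rw [← card_neighborFinset_eq_degree, ← Finset.card_univ,
    ← Finset.card_image_of_injective (f := fun a : A => ((v, .inl a) : V × (A ⊕ B))) _
      (fun a a' h => by simpa using h)]
  congr 1
  ext ⟨u, a | b⟩ <;> simp

open Classical in
theorem meredith_degree_inl_port [Fintype V] [Fintype A] [Fintype B]
    (hπ : ∀ v, Set.InjOn (π v) (G.neighborSet v)) {v w : V} (h : G.Adj v w) :
    (meredith (B := B) G π).degree (v, .inl (π v w)) = Fintype.card B + 1 := by
  rw [← card_neighborFinset_eq_degree, ← Finset.card_univ,
    ← Finset.card_image_of_injective (f := fun b : B => ((v, .inr b) : V × (A ⊕ B))) _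
      (fun a a' h => by simpa using h), ← Finset.card_insert_of_notMem
      (a := ((w, .inl (π w v)) : V × (A ⊕ B))) (by simp)]
  congr 1
  ext ⟨u, a | b⟩
  · simp only [mem_neighborFinset, meredith_inl_inl, Finset.mem_insert, Prod.mk.injEq,
      Sum.inl.injEq, Finset.mem_image, Finset.mem_univ, reduceCtorEq, and_false,
      exists_false, or_false]
    constructor
    · rintro ⟨hu, huw, rfl⟩
      obtain rfl := hπ v h hu huw
      exact ⟨rfl, rfl⟩
    · rintro ⟨rfl, rfl⟩
      exact ⟨h, rfl, rfl⟩
  · simp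

open Classical in
theorem meredith_degree_inl_of_notMem [Fintype V] [Fintype A] [Fintype B] {v : V} {a : A}
    (h : a ∉ π v '' G.neighborSet v) :
    (meredith (B := B) G π).degree (v, .inl a) = Fintype.card B := by
  rw [← card_neighborFinset_eq_degree, ← Finset.card_univ,
    ← Finset.card_image_of_injective (f := fun b : B => ((v, .inr b) : V × (A ⊕ B))) _
      (fun a a' h => by simpa using h)]
  congr 1
  ext ⟨u, a' | b⟩
  · simp only [mem_neighborFinset, meredith_inl_inl, Finset.mem_image, Finset.mem_univ,
      Prod.mk.injEq, reduceCtorEq, and_false, exists_false, iff_false]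
    rintro ⟨hu, rfl, -⟩
    exact h ⟨u, hu, rfl⟩
  · simp

/-- An independent set of `G` yields one of the Meredith extension by taking the side `A` of the
copies of its vertices and the side `B` of all other copies. -/
theorem indepNum_meredith_ge [Fintype V] [Fintype A] [Fintype B]
    (hBA : Fintype.card B + 1 = Fintype.card A) :
    Fintype.card V * Fintype.card B + G.indepNum ≤ (meredith (B := B) G π).indepNum := by
  classical
  obtain ⟨s, hs⟩ := G.exists_isNIndepSet_indepNum
  have hind : (meredith (B := B) G π).IsIndepSet
      (((s ×ˢ Finset.univ.map .inl) ∪ (sᶜ ×ˢ Finset.univ.map .inr) : Finset (V × (A ⊕ B))) :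
        Set (V × (A ⊕ B))) := by
    rintro ⟨u, a | b⟩ hu ⟨v, a' | b'⟩ hv - h
    · have hu : u ∈ s := by simpa using hu
      have hv : v ∈ s := by simpa using hv
      exact hs.1 hu hv h.1.ne h.1
    · obtain rfl : u = v := h
      have hu : u ∈ s := by simpa using hu
      have hv : u ∉ s := by simpa using hv
      exact hv hu
    · obtain rfl : u = v := h
      have hu : u ∉ s := by simpa using hu
      have hv : u ∈ s := by simpa using hv
      exact hu hv
    · exact h
  have := hind.card_le_indepNum
  rw [Finset.card_union_of_disjoint] at this
  · simp only [Finset.card_product, Finset.card_map, Finset.card_univ, Finset.card_compl] at this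
    refine le_trans (le_of_eq ?_) this
    have h1 : s.card ≤ Fintype.card V := s.card_le_univ
    obtain ⟨m, hm⟩ := Nat.exists_eq_add_of_le h1
    rw [← hBA, hm, ← hs.2]
    simp only [Nat.add_sub_cancel_left]
    ring
  · rw [Finset.disjoint_left]
    rintro ⟨u, a | b⟩ <;> simp

/-! ### Path systems -/

/-- `G` has a system of paths `p v i`, `v ∈ S`, `i ∈ I`, starting at `v` and with at least `m + 1`
vertices, that avoid `S` except at `v` and are disjoint except for common initial vertices. For `S`
the set of vertices of degree `k - 1` and `I = Fin (k - 1)` these are the conditions of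
`IsPathSystem`. -/
def HasPathSystem (G : SimpleGraph V) (S : Set V) (I : Type*) (m : ℕ) : Prop :=
  ∃ (q : V → I → V) (p : ∀ v i, G.Walk v (q v i)),
    (∀ v ∈ S, ∀ i, (p v i).IsPath) ∧ (∀ v ∈ S, ∀ i, ∀ x ∈ (p v i).support, x ∈ S → x = v) ∧
    (∀ v ∈ S, ∀ i, m ≤ (p v i).length) ∧
    (∀ v ∈ S, ∀ i j, i ≠ j → ∀ x ∈ (p v i).support, x ∈ (p v j).support → x = v) ∧
    ∀ v ∈ S, ∀ w ∈ S, w ≠ v → ∀ i j, ∀ x ∈ (p v i).support, x ∉ (p w j).support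

theorem hasPathSystem_zero (G : SimpleGraph V) (S : Set V) (I : Type*) : HasPathSystem G S I 0 := by
  refine ⟨fun v _ => v, fun v _ => Walk.nil, ?_, ?_, ?_, ?_, ?_⟩ <;> simp +contextual [eq_comm]

/-- A path of `G` lifts to a longer path of the Meredith extension: it enters the copy of `u` at `a`,
passes through the vertex `b` of the side `B` to the port towards the next vertex, and so on. -/
theorem exists_lift_isPath (hπ : ∀ v, Set.InjOn (π v) (G.neighborSet v)) (b : B) {u w : V}
    (p : G.Walk u w) (hp : p.IsPath) (a : A)
    (ha : ∀ x ∈ p.support, G.Adj u x → a ≠ π u x) :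
    ∃ (y : V × (A ⊕ B)) (q : (meredith G π).Walk (u, .inl a) y), q.IsPath ∧
      p.length < q.length ∧ ∀ z ∈ q.support, z.1 ∈ p.support ∧
        (z.1 = u → z = (u, .inl a) ∨ z = (u, .inr b) ∨
          ∃ x ∈ p.support, G.Adj u x ∧ z = (u, .inl (π u x))) := by
  induction p generalizing a with
  | nil =>
    refine ⟨_, Walk.cons (meredith_inl_inr (b := b).2 rfl) Walk.nil, ?_, ?_, ?_⟩
    · simp
    · simp
    · rintro z hz
      rcases (by simpa using hz : z = _ ∨ z = _) with rfl | rfl <;> simp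
  | @cons u v w h p ih =>
    obtain ⟨hp, hu⟩ := (Walk.cons_isPath_iff h p).1 hp
    obtain ⟨y, q, hq, hlen, hsupp⟩ := ih hp (π v u) (fun x hx hvx he => by
      obtain rfl := hπ v h.symm hvx he
      exact hu hx)
    have hq1 : ∀ s : A ⊕ B, (u, s) ∉ q.support := fun s hs => hu (hsupp _ hs).1
    have hav : a ≠ π u v := ha v (by simp) h
    refine ⟨y, Walk.cons (meredith_inl_inr (b := b).2 rfl)
      (Walk.cons (meredith_inr_inl (a := π u v).2 rfl)
        (Walk.cons (meredith_inl_inl.2 ⟨h, rfl, rfl⟩) q)), ?_, ?_, ?_⟩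
    · simp [Walk.cons_isPath_iff, hq, hq1, hav]
    · simp only [Walk.length_cons]
      omega
    · intro z hz
      simp only [Walk.support_cons, List.mem_cons] at hz ⊢
      rcases hz with rfl | rfl | rfl | hz
      · simp
      · simp
      · exact ⟨Or.inl rfl, fun _ => Or.inr (Or.inr ⟨v, Or.inr (by simp), h, rfl⟩)⟩
      · exact ⟨Or.inr (hsupp z hz).1, fun hzu => absurd (hzu ▸ (hsupp z hz).1) hu⟩

/-- The paths are lifted from the vertices of `T`, each of which is a vertex of the side `A`, but not
a port, in the copy of a vertex of `S`; the `i`-th path leaves the side `A` through the `i`-th vertex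
of the side `I`. -/
theorem HasPathSystem.meredith {I : Type*} {S : Set V} {m : ℕ} (h : HasPathSystem G S I m)
    (hπ : ∀ v, Set.InjOn (π v) (G.neighborSet v)) {T : Set (V × (A ⊕ I))}
    (hT : ∀ z ∈ T, z.1 ∈ S ∧ ∃ a, z.2 = .inl a ∧ a ∉ π z.1 '' G.neighborSet z.1)
    (hinj : ∀ z ∈ T, ∀ z' ∈ T, z.1 = z'.1 → z = z') :
    HasPathSystem (meredith G π) T I (m + 1) := by
  obtain ⟨q, p, hpath, hS, hlen, hsame, hother⟩ := h
  have key : ∀ z i, ∃ (y : V × (A ⊕ I)) (r : (CriticalGraph.meredith G π).Walk z y),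
      z ∈ T → r.IsPath ∧ m + 1 ≤ r.length ∧ ∀ x ∈ r.support, x.1 ∈ (p z.1 i).support ∧
        (x.1 = z.1 → x = z ∨ x = (z.1, .inr i) ∨
          ∃ y ∈ (p z.1 i).support, G.Adj z.1 y ∧ x = (z.1, .inl (π z.1 y))) := by
    rintro ⟨v, s⟩ i
    by_cases hz : (v, s) ∈ T
    · obtain ⟨hv, a, hs, ha⟩ := hT _ hz
      obtain rfl : s = .inl a := hs
      obtain ⟨y, r, hr, hrl, hrs⟩ := exists_lift_isPath hπ i (p v i) (hpath v hv i) a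
        (fun x _ hvx he => ha ⟨x, hvx, he.symm⟩)
      exact ⟨y, r, fun _ => ⟨hr, lt_of_le_of_lt (hlen v hv i) hrl, hrs⟩⟩
    · exact ⟨_, Walk.nil, fun h => absurd h hz⟩
  choose q' p' h' using key
  refine ⟨q', p', fun z hz i => (h' z i hz).1, ?_, fun z hz i => (h' z i hz).2.1, ?_, ?_⟩
  · intro z hz i x hx hxT
    exact hinj x hxT z hz (hS _ (hT z hz).1 i _ ((h' z i hz).2.2 x hx).1 (hT x hxT).1)
  · intro z hz i j hij x hxi hxj
    obtain ⟨hi, hi'⟩ := (h' z i hz).2.2 x hxi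
    obtain ⟨hj, hj'⟩ := (h' z j hz).2.2 x hxj
    have hxz := hsame _ (hT z hz).1 i j hij _ hi hj
    rcases hi' hxz with rfl | rfl | ⟨y, hy, hvy, rfl⟩
    · rfl
    · rcases hj' hxz with h | h | ⟨y', _, _, h⟩
      · exact h
      · exact absurd (by simpa using h) hij
      · simp at h
    · rcases hj' hxz with h | h | ⟨y', hy', hvy', h⟩
      · exact h
      · simp at h
      · obtain rfl := hπ z.1 hvy hvy' (by simpa using h)
        exact absurd (hsame _ (hT z hz).1 i j hij _ hy hy').symm hvy.ne
  · intro z hz z' hz' hne i j x hxi hxj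
    exact hother _ (hT z hz).1 _ (hT z' hz').1 (fun h => hne (hinj _ hz' _ hz h)) i j _
      ((h' z i hz).2.2 x hxi).1 ((h' z' j hz').2.2 x hxj).1

end Meredith

theorem HasPathSystem.exists_isPathSystem {V : Type*} [Fintype V] {G : SimpleGraph V} {k t m : ℕ}
    (h : HasPathSystem G (degreeClass G (k - 1)) (Fin (k - 1)) m) (hm : 2 * t * (k - 1) + 1 ≤ m) :
    ∃ (q : V → Fin (k - 1) → V) (p : ∀ (v : V) (i : Fin (k - 1)), G.Walk v (q v i)),
      IsPathSystem G k t q p := by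
  classical
  obtain ⟨q, p, hpath, hS, hlen, hsame, hother⟩ := h
  refine ⟨q, p, hpath, ?_, ?_, ?_, ?_⟩
  · intro v hv i
    ext x
    constructor
    · rintro ⟨hx, hxS⟩
      exact hS v hv i x hx hxS
    · rintro rfl
      exact ⟨(p x i).start_mem_support, hv⟩
  · intro v hv i
    have h1 : walkVerts (p v i) = ((p v i).support.toFinset : Set V) := by
      ext x
      simp [walkVerts]
    rw [h1, Set.ncard_coe_finset, List.toFinset_card_of_nodup (hpath v hv i).support_nodup,
      Walk.length_support]
    have := hlen v hv i
    omega
  · intro v hv i j hij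
    ext x
    constructor
    · rintro ⟨hx, hx'⟩
      exact hsame v hv i j hij x hx hx'
    · rintro rfl
      exact ⟨(p x i).start_mem_support, (p x j).start_mem_support⟩
  · intro v hv w hw hwv i j
    ext x
    simp only [Set.mem_inter_iff, Set.mem_empty_iff_false, iff_false, not_and]
    exact fun hx hx' => hother v hv w hw hwv i j x hx hx'

/-! ### Criticality and the independence ratio -/

theorem chromaticIndex_eq_succ_iff {V : Type*} (G : SimpleGraph V) (n : ℕ) (hn : 0 < n) :
    chromaticIndex G = (n + 1 : ℕ) ↔ (∃ c : V → V → Fin (n + 1), IsEdgeColoring G c) ∧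
      ¬ ∃ c : V → V → Fin n, IsEdgeColoring G c := by
  rw [← lineGraph_colorable_iff G n hn, ← lineGraph_colorable_iff G (n + 1) n.succ_pos,
    ← chromaticNumber_eq_iff_colorable_not_colorable, chromaticIndex]
  push_cast
  rfl

theorem exists_isEdgeColoring_of_chromaticIndex_le {V : Type*} {G : SimpleGraph V} {n : ℕ}
    (hn : 0 < n) (h : chromaticIndex G ≤ n) : ∃ c : V → V → Fin n, IsEdgeColoring G c := by
  rwa [chromaticIndex, chromaticNumber_le_iff_colorable, lineGraph_colorable_iff G n hn] at h

theorem exists_isEdgeColoring_succ {V : Type*} {G : SimpleGraph V} {n : ℕ} {e : Sym2 V}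
    (h : ∃ c : V → V → Fin n, IsEdgeColoring (G.deleteEdges {e}) c) :
    ∃ c : V → V → Fin (n + 1), IsEdgeColoring G c := by
  classical
  obtain ⟨c, hc⟩ := h
  refine ⟨fun u v => if s(u, v) = e then Fin.last n else (c u v).castSucc, ?_, ?_⟩
  · intro u v huv
    rw [Sym2.eq_swap (a := v) (b := u)]
    by_cases he : s(u, v) = e
    · simp [he]
    · simp [he, hc.symm u v (by simp [huv, he])]
  · intro u v w huv huw h
    by_cases hv : s(u, v) = e <;> by_cases hw : s(u, w) = e
    · exact Sym2.congr_right.1 (hv.trans hw.symm)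
    · simp only [hv, hw, if_true, if_false] at h
      exact absurd h.symm (Fin.castSucc_ne_last _)
    · simp only [hv, hw, if_true, if_false] at h
      exact absurd h (Fin.castSucc_ne_last _)
    · simp only [hv, hw, if_false, Fin.castSucc_inj] at h
      exact hc.inj u v w (by simp [huv, hv]) (by simp [huw, hw]) h

section Critical

variable {V : Type*} [Fintype V] {G : SimpleGraph V} {k : ℕ}

open Classical in
theorem IsCritical.degree_le (h : IsCritical G k) (v : V) : G.degree v ≤ k :=
  h.maxDegree_eq ▸ G.degree_le_maxDegree v

open Classical in
theorem IsCritical.exists_adj (h : IsCritical G k) (hk : 2 ≤ k) (v : V) : ∃ w, G.Adj v w := by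
  have : Nonempty V := h.connected.nonempty
  obtain ⟨u, hu⟩ := G.exists_maximal_degree_vertex
  have hpos : 0 < G.degree u := by rw [← hu, h.maxDegree_eq]; omega
  obtain ⟨x, hx⟩ := (G.degree_pos_iff_exists_adj u).1 hpos
  have : Nontrivial V := ⟨u, x, hx.ne⟩
  exact h.connected.preconnected.exists_adj_of_nontrivial v

theorem IsCritical.exists_ports (h : IsCritical G k) (hk : 2 ≤ k) :
    ∃ π : V → V → Fin k, ∀ v, Set.InjOn (π v) (G.neighborSet v) := by
  classical
  have : ∀ v, ∃ f : V → Fin k, Set.InjOn f (G.neighborSet v) := by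
    intro v
    have hcard : Fintype.card (G.neighborSet v) ≤ Fintype.card (Fin k) := by
      rw [card_neighborSet_eq_degree, Fintype.card_fin]
      exact h.degree_le v
    obtain ⟨f⟩ := Function.Embedding.nonempty_of_card_le hcard
    obtain ⟨w, hw⟩ := h.exists_adj hk v
    refine ⟨fun x => if hx : G.Adj v x then f ⟨x, hx⟩ else f ⟨w, hw⟩, ?_⟩
    intro x hx y hy hxy
    have hx : G.Adj v x := hx
    have hy : G.Adj v y := hy
    simp only [hx, hy, dif_pos] at hxy
    exact congrArg Subtype.val (f.injective hxy)
  choose π hπ using this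
  exact ⟨π, hπ⟩

open Classical in
theorem IsCritical.meredith (h : IsCritical G k) (hk : 2 ≤ k) {π : V → V → Fin k}
    (hπ : ∀ v, Set.InjOn (π v) (G.neighborSet v)) :
    IsCritical (meredith (B := Fin (k - 1)) G π) k := by
  have hBA : Fintype.card (Fin (k - 1)) + 1 = Fintype.card (Fin k) := by simp; omega
  have hnot : ¬ ∃ x : V → V → Fin k, IsEdgeColoring G x :=
    ((chromaticIndex_eq_succ_iff G k (by omega)).1 h.chromaticIndex_eq).2
  have hdel : ∀ e ∈ (CriticalGraph.meredith (B := Fin (k - 1)) G π).edgeSet,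
      ∃ col : _ → _ → Fin k, IsEdgeColoring
        ((CriticalGraph.meredith (B := Fin (k - 1)) G π).deleteEdges {e}) col :=
    fun e he => exists_isEdgeColoring_meredith_deleteEdges hBA rfl hπ
      (by simpa using h.degree_le) (h.exists_adj hk) hnot
      (fun v w hvw => exists_isEdgeColoring_of_chromaticIndex_le (by omega)
        (h.chromaticIndex_deleteEdge _ hvw).le) he
  have hA : Nonempty (Fin k) := ⟨⟨0, by omega⟩⟩
  have hB : Nonempty (Fin (k - 1)) := ⟨⟨0, by omega⟩⟩
  obtain ⟨b₀⟩ := id hB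
  obtain ⟨v₀⟩ := h.connected.nonempty
  refine ⟨meredith_connected h.connected, ?_, ?_, ?_⟩
  · apply le_antisymm
    · refine maxDegree_le_of_forall_degree_le _ _ ?_
      rintro ⟨v, a | b⟩
      · by_cases ha : a ∈ π v '' G.neighborSet v
        · obtain ⟨w, hw, rfl⟩ := ha
          rw [meredith_degree_inl_port hπ hw, hBA, Fintype.card_fin]
        · rw [meredith_degree_inl_of_notMem ha, Fintype.card_fin]
          omega
      · rw [meredith_degree_inr, Fintype.card_fin]
    · refine le_trans (le_of_eq ?_) (degree_le_maxDegree _ (v₀, .inr b₀))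
      rw [meredith_degree_inr, Fintype.card_fin]
  · rw [chromaticIndex_eq_succ_iff _ _ (by omega)]
    refine ⟨?_, fun ⟨col, hcol⟩ => hnot (exists_isEdgeColoring_of_meredith hBA rfl hπ hcol)⟩
    obtain ⟨a₀⟩ := hA
    exact exists_isEdgeColoring_succ (hdel s((v₀, .inl a₀), (v₀, .inr b₀)) rfl)
  · intro e he
    obtain ⟨n, rfl⟩ : ∃ n, k = n + 1 := ⟨k - 1, by omega⟩
    rw [chromaticIndex_eq_succ_iff _ _ (by omega)]
    refine ⟨hdel e he, ?_⟩
    rintro ⟨col, hcol⟩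
    -- Some vertex of degree `n + 1` is not an end of `e`.
    obtain ⟨w, hw⟩ : ∃ w, (w, .inr b₀) ∉ e := by
      induction e using Sym2.ind with
      | _ p q =>
        obtain ⟨u, s⟩ := p
        obtain ⟨v, t⟩ := q
        by_cases huv : u = v
        · subst huv
          obtain ⟨w, hw⟩ := h.exists_adj hk u
          exact ⟨w, by simp [hw.ne']⟩
        · rcases s with a | b <;> rcases t with a' | b'
          · exact ⟨u, by simp⟩
          · exact absurd he huv
          · exact absurd he huv
          · exact he.elim
    have hadj : ∀ a, ((CriticalGraph.meredith (B := Fin (n + 1 - 1)) G π).deleteEdges {e}).Adj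
        (w, .inr b₀) (w, .inl a) := by
      intro a
      rw [deleteEdges_adj]
      refine ⟨rfl, ?_⟩
      rintro rfl
      exact hw (by simp)
    have hinj : Function.Injective fun a : Fin (n + 1) => col (w, .inr b₀) (w, .inl a) :=
      fun a a' haa => by simpa using hcol.inj _ _ _ (hadj a) (hadj a') haa
    simpa using Fintype.card_le_of_injective _ hinj

open Classical in
theorem le_minDegree_meredith [Nonempty V] (hk : 2 ≤ k) {π : V → V → Fin k}
    (hπ : ∀ v, Set.InjOn (π v) (G.neighborSet v)) :
    k - 1 ≤ (meredith (B := Fin (k - 1)) G π).minDegree := by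
  have hB : Nonempty (Fin (k - 1)) := ⟨⟨0, by omega⟩⟩
  refine le_minDegree_of_forall_le_degree _ _ ?_
  rintro ⟨v, a | b⟩
  · by_cases ha : a ∈ π v '' G.neighborSet v
    · obtain ⟨w, hw, rfl⟩ := ha
      rw [meredith_degree_inl_port hπ hw, Fintype.card_fin]
      omega
    · rw [meredith_degree_inl_of_notMem ha, Fintype.card_fin]
  · rw [meredith_degree_inr, Fintype.card_fin]
    omega

open Classical in
theorem HasPathSystem.meredith_degreeClass (hk : 2 ≤ k) (hδ : k - 1 ≤ G.minDegree) {m : ℕ}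
    (h : HasPathSystem G (degreeClass G (k - 1)) (Fin (k - 1)) m) {π : V → V → Fin k}
    (hπ : ∀ v, Set.InjOn (π v) (G.neighborSet v)) :
    HasPathSystem (CriticalGraph.meredith G π)
      (degreeClass (CriticalGraph.meredith (B := Fin (k - 1)) G π) (k - 1)) (Fin (k - 1))
      (m + 1) := by
  have himage : ∀ v, ((G.neighborFinset v).image (π v)).card = G.degree v := fun v => by
    rw [Finset.card_image_of_injOn (by simpa using hπ v), card_neighborFinset_eq_degree]
  have hcoe : ∀ v a, a ∉ π v '' G.neighborSet v → a ∉ (G.neighborFinset v).image (π v) := by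
    intro v a ha
    simpa using ha
  have hT : ∀ z ∈ degreeClass (CriticalGraph.meredith (B := Fin (k - 1)) G π) (k - 1),
      ∃ a, z.2 = .inl a ∧ a ∉ π z.1 '' G.neighborSet z.1 := by
    rintro ⟨v, a | b⟩ hz
    · refine ⟨a, rfl, ?_⟩
      dsimp only
      rintro ⟨w, hw, rfl⟩
      have hz : (CriticalGraph.meredith (B := Fin (k - 1)) G π).degree _ = k - 1 := hz
      rw [meredith_degree_inl_port hπ hw, Fintype.card_fin] at hz
      omega
    · have hz : (CriticalGraph.meredith (B := Fin (k - 1)) G π).degree _ = k - 1 := hz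
      rw [meredith_degree_inr, Fintype.card_fin] at hz
      omega
  refine h.meredith hπ (fun z hz => ⟨?_, hT z hz⟩) ?_
  · obtain ⟨a, -, ha⟩ := hT z hz
    have h1 := Finset.card_lt_univ_of_notMem (hcoe _ _ ha)
    rw [himage, Fintype.card_fin] at h1
    have h2 := hδ.trans (G.minDegree_le_degree z.1)
    show G.degree z.1 = k - 1
    omega
  · -- All but one vertex of the side `A` of a copy are ports.
    intro z hz z' hz' hzz
    obtain ⟨a, haz, ha⟩ := hT z hz
    obtain ⟨a', haz', ha'⟩ := hT z' hz'
    rw [← hzz] at ha'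
    by_contra hne
    have haa : a ≠ a' := fun h => hne (Prod.ext hzz (by rw [haz, haz', h]))
    have hle := Finset.card_le_univ
      (insert a (insert a' ((G.neighborFinset z.1).image (π z.1))))
    rw [Finset.card_insert_of_notMem (by
        rw [Finset.mem_insert, not_or]
        exact ⟨haa, hcoe _ _ ha⟩), Finset.card_insert_of_notMem (hcoe _ _ ha'), himage,
      Fintype.card_fin] at hle
    have h2 := hδ.trans (G.minDegree_le_degree z.1)
    omega

theorem half_lt_indepRatio_iff [Nonempty V] :
    1 / 2 < indepRatio G ↔ Fintype.card V < 2 * G.indepNum := by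
  have h : (0 : ℝ) < Fintype.card V := by exact_mod_cast Fintype.card_pos
  rw [indepRatio, div_lt_div_iff₀ two_pos h, one_mul, mul_comm]
  exact_mod_cast Iff.rfl

theorem half_lt_indepRatio_meredith [Nonempty V] (hk : 2 ≤ k) {π : V → V → Fin k}
    (h : 1 / 2 < indepRatio G) :
    1 / 2 < indepRatio (meredith (B := Fin (k - 1)) G π) := by
  have : Nonempty (Fin k) := ⟨⟨0, by omega⟩⟩
  rw [half_lt_indepRatio_iff] at h ⊢
  have hi := indepNum_meredith_ge (G := G) (π := π) (B := Fin (k - 1)) (by simp; omega)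
  refine lt_of_lt_of_le ?_ (Nat.mul_le_mul_left 2 hi)
  obtain ⟨n, rfl⟩ : ∃ n, k = n + 1 := ⟨k - 1, by omega⟩
  simp only [Fintype.card_prod, Fintype.card_sum, Fintype.card_fin, Nat.add_sub_cancel]
  nlinarith

end Critical

open Classical in
/-- Repeated Meredith extension. After the first step all degrees are at least `k - 1`, and every
further step lengthens the paths, starting from paths with a single vertex. -/
theorem exists_critical_hasPathSystem {V : Type} [Fintype V] {G : SimpleGraph V} {k : ℕ}
    (hk : 2 ≤ k) (hG : IsCritical G k) (hι : 1 / 2 < indepRatio G) (m : ℕ) :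
    ∃ (W : Type) (_ : Fintype W) (H : SimpleGraph W), IsCritical H k ∧ 1 / 2 < indepRatio H ∧
      k - 1 ≤ H.minDegree ∧ HasPathSystem H (degreeClass H (k - 1)) (Fin (k - 1)) m := by
  induction m with
  | zero =>
    obtain ⟨π, hπ⟩ := hG.exists_ports hk
    have := hG.connected.nonempty
    exact ⟨_, inferInstance, meredith (B := Fin (k - 1)) G π, hG.meredith hk hπ,
      half_lt_indepRatio_meredith hk hι, le_minDegree_meredith hk hπ, hasPathSystem_zero _ _ _⟩
  | succ m ih =>
    obtain ⟨W, _, H, hH, hHι, hδ, hp⟩ := ih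
    obtain ⟨π, hπ⟩ := hH.exists_ports hk
    have := hH.connected.nonempty
    refine ⟨_, inferInstance, CriticalGraph.meredith (B := Fin (k - 1)) H π, hH.meredith hk hπ,
      half_lt_indepRatio_meredith hk hHι, ?_, ?_⟩
    · exact le_minDegree_meredith hk hπ
    · exact hp.meredith_degreeClass hk hδ hπ

end CriticalGraph

theorem mainTheorem2 (k t : ℕ) (hk : 2 ≤ k) :
    CriticalGraph.iota k ≤ 1 / 2 ↔ CriticalGraph.iotaC k t ≤ 1 / 2 := by
  open CriticalGraph in
  constructor
  · intro h
    -- The supremum of the empty set is `0`, so the class `C(k, t)` may be empty here.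
    refine Real.sSup_le ?_ (by norm_num)
    rintro _ ⟨V, _, G, hG, rfl⟩
    exact (le_csSup (bddAbove_ratioSet k) ⟨V, _, G, hG.isCritical, rfl⟩).trans h
  · intro h
    refine Real.sSup_le ?_ (by norm_num)
    rintro _ ⟨V, _, G, hG, rfl⟩
    by_contra! hι
    obtain ⟨W, _, H, hH, hHι, hδ, hp⟩ :=
      exists_critical_hasPathSystem hk hG hι (2 * t * (k - 1) + 1)
    have hC : MemC H k t := ⟨hH, hδ, hp.exists_isPathSystem le_rfl⟩
    exact absurd ((le_csSup (bddAbove_ratioSetC k t) ⟨W, _, H, hC, rfl⟩).trans h) (not_le.2 hHι)
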